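/- Conventions. A graph is a graph in the sense of Serre: it has directed edges, each with an origin and a terminus, and a fixed point free inversion $e\mapsto\bar e$. A square complex is a graph together with a set of directed squares, each having a circle of length four as boundary, and a free action of the dihedral group $D_4$ on the directed squares compatible with its action on circles of length four. The link of a vertex $v$ is the graph whose vertices are the directed edges with origin $v$ and whose edges are the corners of squares at $v$, a corner joining the two sides of the square which start there. A VH-complex is a square complex with a partition of its geometric edges into horizontal and vertical ones which is a bipartition of every link; it is a VH-T-complex if every link is the complete bipartite graph on its horizontal and vertical vertices. Let $\Sigma$ be a finite VH-T-complex with one vertex. The automaton $A^T(\Sigma)$ has as alphabet the directed horizontal edges and as states the directed vertical edges of $\Sigma$. For a letter $x$ and a state $q$, the output $\lambda(q,x)$ and the next state $\pi(q,x)$ are the edges opposite to $x$ and to $q$, respectively, in the unique square incident to $x$ and $q$ near their origins. The initial automaton $(A^T(\Sigma),q)$ defines the length-preserving transformation of words given by $\emptyset\mapsto\emptyset$ and $(A^T(\Sigma),q)(xw)=\lambda(q,x)\,(A^T(\Sigma),\pi(q,x))(w)$. Let $X$ be a finite set, $X^{\pm}=X\sqcup X^{-1}$, $F_X$ the free group on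 $X$, and $T=\mathrm{Cay}(F_X,X)$ its Cayley graph, on which $F_X$ acts by left multiplication. Let $$C=\{g\in\mathrm{Aut}(T) : gF_Xg^{-1}\cap F_X \text{ has finite index in both } F_X \text{ and } gF_Xg^{-1}\}$$ be the commensurator of $F_X$ in $\mathrm{Aut}(T)$, and let $C_O$ be the stabilizer in $C$ of the base vertex $O=1\in F_X$. Let $\phi:(X^{\pm})^*\to F_X$ be the natural monoid homomorphism. Theorem. $T$ is a tree in which every vertex has exactly $2|X|$ neighbours, and left multiplication embeds $F_X$ as a uniform lattice in $\mathrm{Aut}(T)$ (vertex stabilizers are finite and the quotient is finite). The set of all transformations $(A^T(\Sigma),q)$ of $(X^{\pm})^*$, where $\Sigma$ is a finite VH-T-complex with one vertex whose set of directed horizontal edges is identified with $X^{\pm}$ compatibly with inversion, and $q$ is a directed vertical edge of $\Sigma$, is a group under composition. This group is naturally isomorphic to $C_O$: there is a group isomorphism $\Psi$ from it onto $C_O$ such that $\Psi(f)(\phi(w))=\phi(f(w))$ for every transformation $f$ in the group and every word $w\in(X^{\pm})^*$. -/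

import Mathlib

universe u v w

/-! ### Finite synchronous automata and their transformations -/

/-- A synchronous automaton with alphabet `X` and set of states `Q`: the transition function
`next` and the output function `out`. -/
structure Automaton (X : Type u) (Q : Type v) where
  next : X → Q → Q
  out : X → Q → X

namespace Automaton

variable {X : Type u} {Q : Type v}

/-- The length preserving transformation of words defined by the initial automaton `(A, q)`. -/
def transform (A : Automaton X Q) : Q → List X → List X
  | _, [] => []
  | q, x :: w => A.out x q :: A.transform (A.next x q) w

/-- Renaming the letters of the alphabet along a bijection. -/
def relabel {X' : Type w} (A : Automaton X Q) (f : X ≃ X') : Automaton X' Q where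
  next x q := A.next (f.symm x) q
  out x q := f (A.out (f.symm x) q)

end Automaton

/-! ### Graphs with directed edges and edge inversion -/

/-- A graph in the sense of Serre (loops and multiple edges are allowed): origin and terminus
maps, and a fixed point free edge inversion. -/
structure SerreGraph (V : Type u) (E : Type v) where
  o : E → V
  t : E → V
  inv : E → E
  inv_inv : ∀ e, inv (inv e) = e
  inv_ne : ∀ e, inv e ≠ e
  o_inv : ∀ e, o (inv e) = t e

namespace SerreGraph

variable {V : Type u} {E : Type v}

/-- A morphism of graphs. (Compatibility with `t` follows from that with `o` and `inv`.) -/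
structure Hom {V' : Type*} {E' : Type*} (G : SerreGraph V E) (G' : SerreGraph V' E') where
  onV : V → V'
  onE : E → E'
  o_onE : ∀ e, G'.o (onE e) = onV (G.o e)
  inv_onE : ∀ e, G'.inv (onE e) = onE (G.inv e)

/-- The set of vertices `A` and its complement form a bipartition of the graph. -/
def IsBipartition (G : SerreGraph V E) (A : Set V) : Prop :=
  ∀ e, G.o e ∈ A ↔ G.t e ∉ A

/-- The graph is the complete bipartite graph on `A` and its complement: it is bipartite, and
each pair of vertices on different sides is joined by exactly one edge. -/
def IsCompleteBipartite (G : SerreGraph V E) (A : Set V) : Prop :=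
  G.IsBipartition A ∧ ∀ a ∈ A, ∀ b ∉ A, ∃! e, G.o e = a ∧ G.t e = b

end SerreGraph

/-! ### The circle of length four with its dihedral symmetries -/

/-- The directed edges `[i, j]`, `i - j = ± 1`, of the circle with vertex set `ZMod 4`. -/
abbrev Circ4Edge : Type := {p : ZMod 4 × ZMod 4 // p.1 - p.2 = 1 ∨ p.1 - p.2 = -1}

/-- The circle of length four. -/
def circ4 : SerreGraph (ZMod 4) Circ4Edge where
  o e := e.1.1
  t e := e.1.2
  inv e := ⟨(e.1.2, e.1.1), by revert e; decide⟩
  inv_inv _ := rfl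
  inv_ne := by decide
  o_inv _ := rfl

/-- The action of the dihedral group of order `8` on the vertices of the circle: `r i` is the
rotation `k ↦ i + k` and `sr i` is the reflection `k ↦ - i - k`. -/
def circ4Act : DihedralGroup 4 → ZMod 4 → ZMod 4
  | .r i, k => i + k
  | .sr i, k => -i - k

theorem circ4Act_one (k : ZMod 4) : circ4Act 1 k = k := by
  rw [DihedralGroup.one_def]; simp [circ4Act]

theorem circ4Act_mul (g h : DihedralGroup 4) (k : ZMod 4) :
    circ4Act (g * h) k = circ4Act g (circ4Act h k) := by
  cases g <;> cases h <;> simp [circ4Act] <;> ring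

/-- The induced action on the edges: `g [i, j] = [g i, g j]`. -/
def circ4ActEdge (g : DihedralGroup 4) (e : Circ4Edge) : Circ4Edge :=
  ⟨(circ4Act g e.1.1, circ4Act g e.1.2), by
    obtain ⟨⟨i, j⟩, h⟩ := e
    revert i j
    rcases g with a | a <;> revert a <;> decide⟩

/-- The directed edge from `i` to `j`. -/
abbrev circ4Edge (i j : ZMod 4) (h : i - j = 1 ∨ i - j = -1 := by decide) : Circ4Edge :=
  ⟨(i, j), h⟩

/-! ### Square complexes -/

/-- A square complex: a graph, a set `S` of directed squares with a boundary map to circles of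
length four, and a fixed point free action of the dihedral group of order `8` on `S` which is
compatible with its action on circles of length four, `∂ (g • s) = ∂ s ∘ g⁻¹`. -/
structure SquareComplex where
  V : Type u
  E : Type u
  S : Type u
  graph : SerreGraph V E
  bdry : S → circ4.Hom graph
  [action : MulAction (DihedralGroup 4) S]
  smul_free : ∀ (g : DihedralGroup 4) (s : S), g • s = s → g = 1
  bdry_smul : ∀ (g : DihedralGroup 4) (s : S) (e : Circ4Edge),
    (bdry (g • s)).onE (circ4ActEdge g e) = (bdry s).onE e

attribute [instance] SquareComplex.action

namespace SquareComplex

variable (Y : SquareComplex.{u})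

/-- The edge `∂ s ([i, j])` of the directed square `s`. The corners of a square are, in cyclic
order, `0, 1, 2, 3`. -/
abbrev side (s : Y.S) (i j : ZMod 4) (h : i - j = 1 ∨ i - j = -1 := by decide) : Y.E :=
  (Y.bdry s).onE (circ4Edge i j h)

theorem o_side (s : Y.S) (i j : ZMod 4) (h : i - j = 1 ∨ i - j = -1) :
    Y.graph.o (Y.side s i j h) = (Y.bdry s).onV i :=
  (Y.bdry s).o_onE _

theorem inv_side (s : Y.S) (i j : ZMod 4) (h : i - j = 1 ∨ i - j = -1)
    (h' : j - i = 1 ∨ j - i = -1) : Y.graph.inv (Y.side s i j h) = Y.side s j i h' :=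
  (Y.bdry s).inv_onE _

/-- The reflection of a square that fixes its corner `0` and exchanges `1` and `3`. -/
theorem side_reflect (s : Y.S) :
    Y.side (DihedralGroup.sr (0 : ZMod 4) • s) 0 1 = Y.side s 0 3 ∧
      Y.side (DihedralGroup.sr (0 : ZMod 4) • s) 0 3 = Y.side s 0 1 :=
  ⟨Y.bdry_smul (.sr 0) s (circ4Edge 0 3), Y.bdry_smul (.sr 0) s (circ4Edge 0 1)⟩

/-- The link of a vertex `v`. Its vertices are the directed edges with origin `v`. Its directed
edges are the directed squares based at `v` (whose corner `0` is at `v`); such a square joins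
its two sides at this corner, and the reflection in this corner inverts the edge. -/
def link (v : Y.V) : SerreGraph {e : Y.E // Y.graph.o e = v} {s : Y.S // (Y.bdry s).onV 0 = v} where
  o s := ⟨Y.side s.1 0 1, (Y.o_side _ _ _ _).trans s.2⟩
  t s := ⟨Y.side s.1 0 3, (Y.o_side _ _ _ _).trans s.2⟩
  inv s := ⟨DihedralGroup.sr (0 : ZMod 4) • s.1, by
    rw [← Y.o_side _ 0 1 (by decide), (Y.side_reflect s.1).1, Y.o_side, s.2]⟩
  inv_inv s := Subtype.ext <| by
    change DihedralGroup.sr (0 : ZMod 4) • DihedralGroup.sr (0 : ZMod 4) • s.1 = s.1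
    rw [smul_smul, DihedralGroup.sr_mul_sr, sub_self, ← DihedralGroup.one_def, one_smul]
  inv_ne s h := absurd (Y.smul_free _ _ (congrArg Subtype.val h)) (by decide)
  o_inv s := Subtype.ext (Y.side_reflect s.1).1

end SquareComplex

/-- A VH-complex: a square complex with a partition of its geometric edges into horizontal and
vertical ones (the complement of `horizontal`) which is a bipartition of every link. -/
structure VHComplex extends SquareComplex.{u} where
  horizontal : Set E
  inv_mem : ∀ e, graph.inv e ∈ horizontal ↔ e ∈ horizontal
  link_bipartite : ∀ v, (toSquareComplex.link v).IsBipartition {e | e.1 ∈ horizontal}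

namespace VHComplex

variable (Y : VHComplex.{u})

/-- The complex is a VH-T-complex: every link is a complete bipartite graph. -/
def IsVHT : Prop :=
  ∀ v, (Y.link v).IsCompleteBipartite {e | e.1 ∈ Y.horizontal}

/-- The complex is finite. -/
def IsFinite : Prop := Finite Y.V ∧ Finite Y.E ∧ Finite Y.S

/-- The complex has exactly one vertex. -/
def HasOneVertex : Prop := ∃ O : Y.V, ∀ v, v = O

/-- The directed horizontal edges. -/
abbrev HEdge : Type u := {e : Y.E // e ∈ Y.horizontal}

/-- The directed vertical edges. -/
abbrev VEdge : Type u := {e : Y.E // e ∉ Y.horizontal}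

/-- The inversion of directed horizontal edges. -/
def hinv (x : Y.HEdge) : Y.HEdge := ⟨Y.graph.inv x.1, (Y.inv_mem _).2 x.2⟩

theorem corner (s : Y.S) : Y.side s 0 1 ∈ Y.horizontal ↔ Y.side s 0 3 ∉ Y.horizontal :=
  Y.link_bipartite _ ⟨s, rfl⟩

theorem top_mem (s : Y.S) : Y.side s 3 2 ∈ Y.horizontal ↔ Y.side s 0 1 ∈ Y.horizontal := by
  have h := Y.corner (DihedralGroup.r (1 : ZMod 4) • s)
  have h1 : Y.side (DihedralGroup.r (1 : ZMod 4) • s) 0 1 = Y.side s 3 0 :=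
    Y.bdry_smul (.r 1) s (circ4Edge 3 0)
  have h2 : Y.side (DihedralGroup.r (1 : ZMod 4) • s) 0 3 = Y.side s 3 2 :=
    Y.bdry_smul (.r 1) s (circ4Edge 3 2)
  rw [h1, h2, ← Y.inv_side s 0 3 (by decide), Y.inv_mem] at h
  have h0 := Y.corner s
  tauto

theorem right_mem (s : Y.S) : Y.side s 1 2 ∈ Y.horizontal ↔ Y.side s 0 3 ∈ Y.horizontal := by
  have h := Y.corner (DihedralGroup.r (3 : ZMod 4) • s)
  have h1 : Y.side (DihedralGroup.r (3 : ZMod 4) • s) 0 1 = Y.side s 1 2 :=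
    Y.bdry_smul (.r 3) s (circ4Edge 1 2)
  have h2 : Y.side (DihedralGroup.r (3 : ZMod 4) • s) 0 3 = Y.side s 1 0 :=
    Y.bdry_smul (.r 3) s (circ4Edge 1 0)
  rw [h1, h2, ← Y.inv_side s 0 1 (by decide), Y.inv_mem] at h
  have h0 := Y.corner s
  tauto

variable {Y}

/-- In a VH-T-complex with one vertex, a horizontal and a vertical directed edge are incident,
near their origins, to a unique square. -/
theorem existsUnique_square (h1 : Y.HasOneVertex) (hT : Y.IsVHT) (x : Y.HEdge) (q : Y.VEdge) :
    ∃! s : Y.S, Y.side s 0 1 = x.1 ∧ Y.side s 0 3 = q.1 := by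
  obtain ⟨O, hO⟩ := h1
  obtain ⟨s, ⟨hs1, hs2⟩, hs⟩ := (hT O).2 ⟨x.1, hO _⟩ x.2 ⟨q.1, hO _⟩ q.2
  refine ⟨s.1, ⟨congrArg Subtype.val hs1, congrArg Subtype.val hs2⟩, fun s' h' => ?_⟩
  exact congrArg Subtype.val (hs ⟨s', hO _⟩ ⟨Subtype.ext h'.1, Subtype.ext h'.2⟩)

/-- The unique directed square with lower side `x` and left side `q`. -/
noncomputable def square (h1 : Y.HasOneVertex) (hT : Y.IsVHT) (x : Y.HEdge) (q : Y.VEdge) : Y.S :=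
  (existsUnique_square h1 hT x q).choose

theorem square_spec (h1 : Y.HasOneVertex) (hT : Y.IsVHT) (x : Y.HEdge) (q : Y.VEdge) :
    Y.side (square h1 hT x q) 0 1 = x.1 ∧ Y.side (square h1 hT x q) 0 3 = q.1 :=
  (existsUnique_square h1 hT x q).choose_spec.1

/-- The automaton `A^T(Y)` of a VH-T-complex with one vertex. Its letters are the directed
horizontal edges and its states are the directed vertical edges. The output and the next state
are the edges opposite to `x` and to `q` in the unique square incident to `x` and `q` near
their origins. -/
noncomputable def automatonT (h1 : Y.HasOneVertex) (hT : Y.IsVHT) : Automaton Y.HEdge Y.VEdge where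
  next x q := ⟨Y.side (square h1 hT x q) 1 2, by
    rw [Y.right_mem, (square_spec h1 hT x q).2]; exact q.2⟩
  out x q := ⟨Y.side (square h1 hT x q) 3 2, by
    rw [Y.top_mem, (square_spec h1 hT x q).1]; exact x.2⟩

end VHComplex

/-- The transformations of words in the alphabet `X^± = X × Bool` (with `(x, true)` for `x` and
`(x, false)` for its formal inverse) of the form `(A^T(Y), q)`, where `Y` is a finite VH-T-complex
with one vertex whose directed horizontal edges are labelled by `X^±`, compatibly with inversion,
and `q` is a directed vertical edge of `Y`. -/
def vhtTransformations (X : Type u) : Set (List (X × Bool) → List (X × Bool)) :=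
  {f | ∃ (Y : VHComplex.{u}) (_ : Y.IsFinite) (h1 : Y.HasOneVertex) (hT : Y.IsVHT)
      (l : Y.HEdge ≃ X × Bool) (_ : ∀ x, l (Y.hinv x) = ((l x).1, !(l x).2)) (q : Y.VEdge),
      f = ((VHComplex.automatonT h1 hT).relabel l).transform q}

/-! ### The tree and the commensurator -/

/-- The Cayley graph of the free group on `X`: `g` is adjacent to `g x` for `x ∈ X`. -/
abbrev cayleyTree (X : Type u) : SimpleGraph (FreeGroup X) :=
  SimpleGraph.mulCayley (Set.range FreeGroup.of)

/-- The automorphism group of a graph. -/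
abbrev GraphAut {V : Type u} (G : SimpleGraph V) : Type u := G ≃g G

/-- A uniform lattice in the automorphism group of a locally finite graph: the stabilizers of the
vertices are finite (that is, the subgroup is discrete) and the quotient graph is finite. -/
def IsUniformLattice {V : Type u} {G : SimpleGraph V} (Γ : Subgroup (GraphAut G)) : Prop :=
  (∀ v : V, Finite (MulAction.stabilizer Γ v)) ∧ Finite (MulAction.orbitRel.Quotient Γ V)

/-- The action of the free group on its Cayley graph by left multiplication. -/
def leftMulHom (X : Type u) : FreeGroup X →* GraphAut (cayleyTree X) where
  toFun g :=
    { toEquiv := Equiv.mulLeft g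
      map_rel_iff' := by
        intro a b
        simp [SimpleGraph.mulCayley_adj', mul_assoc] }
  map_one' := by ext a; simp
  map_mul' g h := by ext a; simp

/-- The free group on `X` as a subgroup of the automorphism group of its Cayley graph. -/
def freeLattice (X : Type u) : Subgroup (GraphAut (cayleyTree X)) := (leftMulHom X).range

/-- The stabilizer of the base vertex `1` in the commensurator of the free group on `X` in the
automorphism group of its Cayley graph. -/
def commensuratorStabilizer (X : Type u) : Subgroup (GraphAut (cayleyTree X)) :=
  Subgroup.Commensurable.commensurator (freeLattice X) ⊓
    MulAction.stabilizer (GraphAut (cayleyTree X)) (1 : FreeGroup X)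

/-! An automorphism `p` of the tree fixing `1` has a section at every `w`, namely `u ↦ (p w)⁻¹ * p
(w * u)`, again an automorphism fixing `1`. In terms of left multiplications, `p L_w = L_{p w} p_w`,
where `p_w` is the section. Hence `p L_{w v⁻¹} p⁻¹` is a left multiplication exactly when `p_w =
p_v`, and the index of `F ∩ p⁻¹Fp` in `F` is the number of sections. So `p` commensurates the free
group iff it has finitely many sections (`mem_commensurator_iff`), that is, iff it is computed by a
finite automaton whose states are sections.

These automata match one-vertex complexes. Reading a square from its other corners gives the
identities `IsReversible`; they make every state descend from words to an automorphism of the tree,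
with at most as many sections as there are states (`isReversible_automatonT`,
`finite_range_sectionAt`).

Conversely, the sections of `p` and their inverses form a finite reversible automaton. Its labelled
square boundaries form a VH-T-complex, provided that no state is its own inverse and no square is
fixed by the half turn. Doubling each state with a flag flipped by inversion ensures both
(`isReversible_sectionAutomaton`, `IsReversible.transform_mem_vhtTransformations`). -/

/-! ### The Cayley graph of the free group -/

section CayleyTree

variable {X : Type u}

/-- The formal inverse of a letter. -/
def letterInv (x : X × Bool) : X × Bool := (x.1, !x.2)

@[simp]
theorem letterInv_letterInv (x : X × Bool) : letterInv (letterInv x) = x := by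
  simp [letterInv]

theorem letterInv_ne (x : X × Bool) : letterInv x ≠ x := by
  obtain ⟨x, b⟩ := x
  simp [letterInv]

/-- The element of the free group given by a letter. -/
def letterElt (x : X × Bool) : FreeGroup X := FreeGroup.mk [x]

theorem toWord_letterElt [DecidableEq X] (x : X × Bool) : (letterElt x).toWord = [x] := by
  rw [letterElt, FreeGroup.toWord_mk, FreeGroup.reduce_singleton]

theorem letterElt_injective : Function.Injective (letterElt (X := X)) := by
  classical
  intro x y h
  have := congrArg FreeGroup.toWord h
  simpa [toWord_letterElt] using this

theorem letterElt_ne_one (x : X × Bool) : letterElt x ≠ 1 := by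
  classical
  intro h
  have := congrArg FreeGroup.toWord h
  simp [toWord_letterElt] at this

@[simp]
theorem letterElt_letterInv (x : X × Bool) : letterElt (letterInv x) = (letterElt x)⁻¹ := by
  simp [letterElt, letterInv, FreeGroup.inv_mk, FreeGroup.invRev]

theorem mk_cons (x : X × Bool) (w : List (X × Bool)) :
    FreeGroup.mk (x :: w) = letterElt x * FreeGroup.mk w := by
  simp [letterElt, FreeGroup.mul_mk]

theorem cayleyTree_adj {a b : FreeGroup X} :
    (cayleyTree X).Adj a b ↔ ∃ x, b = a * letterElt x := by
  rw [SimpleGraph.mulCayley_adj']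
  constructor
  · rintro ⟨-, _, ⟨x, rfl⟩, h | h⟩
    · exact ⟨(x, true), h.symm⟩
    · refine ⟨letterInv (x, true), ?_⟩
      rw [letterElt_letterInv, h]
      exact (mul_inv_cancel_right b (FreeGroup.of x)).symm
  · rintro ⟨⟨x, b⟩, rfl⟩
    refine ⟨fun h => letterElt_ne_one (x, b) (by simpa using h.symm), FreeGroup.of x, ⟨x, rfl⟩, ?_⟩
    cases b
    · right
      have := letterElt_letterInv (x, true)
      simp only [letterInv, Bool.not_true] at this
      rw [this]
      exact (inv_mul_cancel_right a (FreeGroup.of x)).symm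
    · exact Or.inl rfl

theorem cayleyTree_adj_mul (a : FreeGroup X) (x : X × Bool) :
    (cayleyTree X).Adj a (a * letterElt x) :=
  cayleyTree_adj.2 ⟨x, rfl⟩

theorem cayleyTree_connected : (cayleyTree X).Connected := by
  classical
  have key (w : List (X × Bool)) : ∀ a, (cayleyTree X).Reachable a (a * FreeGroup.mk w) := by
    induction w with
    | nil => intro a; simp [← FreeGroup.one_eq_mk]
    | cons x w ih =>
      intro a
      rw [mk_cons, ← mul_assoc]
      exact (cayleyTree_adj_mul a x).reachable.trans (ih _)
  refine ⟨fun a b => ?_⟩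
  have := key (a⁻¹ * b).toWord a
  rwa [FreeGroup.mk_toWord, mul_inv_cancel_left] at this

/-- Left multiplication by a letter changes the last letter of a reduced word only when it starts
or ends at the identity. -/
theorem getLast?_toWord_letterElt_mul [DecidableEq X] (x : X × Bool) {u : FreeGroup X} (h1 : u ≠ 1)
    (h2 : letterElt x * u ≠ 1) :
    (letterElt x * u).toWord.getLast? = u.toWord.getLast? := by
  have h : (letterElt x * u).toWord = FreeGroup.reduce (x :: u.toWord) := by
    rw [FreeGroup.toWord_mul, toWord_letterElt]; rfl
  rw [FreeGroup.reduce.cons, FreeGroup.reduce_toWord] at h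
  rw [Ne, ← FreeGroup.toWord_eq_nil_iff] at h1 h2
  rw [h] at h2 ⊢
  cases hu : u.toWord with
  | nil => exact absurd hu h1
  | cons y t =>
    rw [hu] at h2
    by_cases hxy : x.1 = y.1 ∧ x.2 = !y.2
    · cases t with
      | nil => simp [hxy] at h2
      | cons z t => simp [hxy]
    · simp [hxy]

/-- Every edge is a bridge: membership in the set of vertices beyond the edge is unchanged along
every other edge. -/
theorem cayleyTree_isAcyclic : (cayleyTree X).IsAcyclic := by
  classical
  rw [SimpleGraph.isAcyclic_iff_forall_adj_isBridge]
  intro a b hab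
  obtain ⟨x, rfl⟩ := cayleyTree_adj.1 hab
  rw [SimpleGraph.isBridge_iff]
  intro hr
  -- The vertices whose reduced path to `a` arrives through `a * letterElt x`. This set contains `a
  -- * letterElt x` but not `a`.
  let S : Set (FreeGroup X) := {v | (v⁻¹ * a).toWord.getLast? = some (letterInv x)}
  have step (v : FreeGroup X) (y : X × Bool) (hne : s(v, v * letterElt y) ≠ s(a, a * letterElt x)) :
      v ∈ S ↔ v * letterElt y ∈ S := by
    have e : (v * letterElt y)⁻¹ * a = letterElt (letterInv y) * (v⁻¹ * a) := by
      rw [letterElt_letterInv]; group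
    simp only [S, Set.mem_ofPred_eq, e]
    -- The last letter of the path to `a` can change only if one end of the edge is `a` itself;
    -- these two cases use that the edge is not the deleted one.
    by_cases h1 : v⁻¹ * a = 1
    · obtain rfl : v = a := inv_mul_eq_one.1 h1
      have : y ≠ x := by rintro rfl; exact hne rfl
      simp only [inv_mul_cancel, mul_one, toWord_letterElt, FreeGroup.toWord_one,
        List.getLast?_nil, List.getLast?_singleton, Option.some.injEq, reduceCtorEq, false_iff]
      intro h
      exact this (by rw [← letterInv_letterInv y, h, letterInv_letterInv])
    · by_cases h2 : letterElt (letterInv y) * (v⁻¹ * a) = 1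
      · have h3 : v⁻¹ * a = letterElt y := by
          rw [letterElt_letterInv, inv_mul_eq_one] at h2; exact h2.symm
        have h4 : v * letterElt y = a := by rw [← h3]; group
        rw [h2, h3]
        simp only [toWord_letterElt, FreeGroup.toWord_one,
          List.getLast?_nil, List.getLast?_singleton, Option.some.injEq, reduceCtorEq, iff_false]
        rintro rfl
        apply hne
        rw [h4, ← h4, letterElt_letterInv]
        simp [Sym2.eq_swap]
      · rw [getLast?_toWord_letterElt_mul _ h1 h2]
  have inv {v w : FreeGroup X}
      (h : ((cayleyTree X).deleteEdges {s(a, a * letterElt x)}).Reachable v w) :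
      v ∈ S ↔ w ∈ S := by
    obtain ⟨p⟩ := h
    induction p with
    | nil => rfl
    | cons hvw _ ih =>
      rw [← ih]
      rw [SimpleGraph.deleteEdges_adj] at hvw
      obtain ⟨y, rfl⟩ := cayleyTree_adj.1 hvw.1
      exact step _ y hvw.2
  have h := (inv hr).2
    (by simp [S, ← letterElt_letterInv, toWord_letterElt])
  simp [S] at h

theorem cayleyTree_isTree : (cayleyTree X).IsTree :=
  ⟨cayleyTree_connected, cayleyTree_isAcyclic⟩

theorem encard_neighborSet_cayleyTree [Finite X] (v : FreeGroup X) :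
    ((cayleyTree X).neighborSet v).encard = (2 * Nat.card X : ℕ) := by
  have h : (cayleyTree X).neighborSet v = Set.range (fun x => v * letterElt x) := by
    ext b
    rw [SimpleGraph.mem_neighborSet, cayleyTree_adj]
    simp [eq_comm]
  have hi : Function.Injective (fun x : X × Bool => v * letterElt x) :=
    (mul_right_injective v).comp letterElt_injective
  rw [h, ← Set.image_univ, hi.encard_image, Set.encard_univ, ENat.card_eq_coe_natCard,
    Nat.card_prod, mul_comm]
  simp

/-! ### Left multiplication as a lattice. -/

@[simp]
theorem leftMulHom_apply (g a : FreeGroup X) : leftMulHom X g a = g * a := rfl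

theorem leftMulHom_injective : Function.Injective (leftMulHom X) := by
  intro g h e
  simpa using congrArg (fun k : GraphAut (cayleyTree X) => k 1) e

/-- Left multiplication is free and transitive on vertices, so stabilizers are trivial and the
quotient is a point. -/
theorem isUniformLattice_freeLattice : IsUniformLattice (freeLattice X) := by
  refine ⟨fun v => ?_, ?_⟩
  · have : Subsingleton (MulAction.stabilizer (freeLattice X) v) := by
      refine subsingleton_of_forall_eq 1 ?_
      rintro ⟨⟨_, g, rfl⟩, hg⟩
      have hg' : g * v = v := hg
      obtain rfl : g = 1 := by simpa using hg'
      exact Subtype.ext (Subtype.ext (map_one _))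
    infer_instance
  · have : Subsingleton (MulAction.orbitRel.Quotient (freeLattice X) (FreeGroup X)) := by
      refine ⟨fun a b => ?_⟩
      induction a using Quotient.inductionOn with | _ a
      induction b using Quotient.inductionOn with | _ b
      refine Quotient.sound ⟨⟨leftMulHom X (a * b⁻¹), _, rfl⟩, ?_⟩
      exact inv_mul_cancel_right a b
    infer_instance

end CayleyTree

/-! ### Sections of automorphisms fixing the base vertex -/

/-- A morphism of automata over a fixed alphabet preserves transformations. This is how concrete
automata are compared with the universal one and with those of complexes. -/
theorem Automaton.transform_eq_of_semiconj {Z : Type u} {Q : Type v} {R : Type w}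
    {A : Automaton Z Q} {B : Automaton Z R} {f : Q → R}
    (ho : ∀ x q, B.out x (f q) = A.out x q) (hn : ∀ x q, B.next x (f q) = f (A.next x q))
    (q : Q) (w : List Z) : B.transform (f q) w = A.transform q w := by
  induction w generalizing q with
  | nil => rfl
  | cons x w ih => simp only [Automaton.transform, ho, hn, ih]

section Sections

variable {X : Type u}

/-- The automorphisms of the Cayley graph which fix the base vertex. -/
abbrev baseStabilizer (X : Type u) : Subgroup (GraphAut (cayleyTree X)) :=
  MulAction.stabilizer (GraphAut (cayleyTree X)) (1 : FreeGroup X)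

namespace baseStabilizer

instance : CoeFun (baseStabilizer X) (fun _ => FreeGroup X → FreeGroup X) where
  coe p := p.1

@[ext]
theorem ext {p q : baseStabilizer X} (h : ∀ v, p v = q v) : p = q :=
  Subtype.ext (RelIso.ext h)

@[simp]
theorem apply_one (p : baseStabilizer X) : p 1 = 1 := p.2

@[simp]
theorem mul_apply (p q : baseStabilizer X) (v : FreeGroup X) : (p * q) v = p (q v) := rfl

@[simp]
theorem inv_apply_self (p : baseStabilizer X) (v : FreeGroup X) : p⁻¹ (p v) = v :=
  p.1.symm_apply_apply v

@[simp]
theorem apply_inv_self (p : baseStabilizer X) (v : FreeGroup X) : p (p⁻¹ v) = v :=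
  p.1.apply_symm_apply v

/-- The section of `p` at `w`: the map induced by `p` on the tree seen from `w`. -/
def sectionAt (p : baseStabilizer X) (w : FreeGroup X) : baseStabilizer X :=
  ⟨(leftMulHom X (p w))⁻¹ * p.1 * leftMulHom X w, by
    change (leftMulHom X (p w))⁻¹ (p (w * 1)) = 1
    rw [← map_inv, leftMulHom_apply]
    simp⟩

@[simp]
theorem sectionAt_apply (p : baseStabilizer X) (w v : FreeGroup X) :
    sectionAt p w v = (p w)⁻¹ * p (w * v) := by
  change (leftMulHom X (p w))⁻¹ (p (w * v)) = _
  rw [← map_inv]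
  rfl

theorem sectionAt_sectionAt (p : baseStabilizer X) (w v : FreeGroup X) :
    sectionAt (sectionAt p w) v = sectionAt p (w * v) := by
  ext u
  simp [mul_assoc]

@[simp]
theorem sectionAt_one (p : baseStabilizer X) : sectionAt p 1 = p := by
  ext u
  simp

theorem mul_sectionAt (p q : baseStabilizer X) (w : FreeGroup X) :
    sectionAt (p * q) w = sectionAt p (q w) * sectionAt q w := by
  ext u
  simp

/-- Since `p` maps the tree seen from `w` to the tree seen from `p w`, its inverse maps it back.
Finiteness of the set of sections thus passes to inverses. -/
theorem inv_sectionAt (p : baseStabilizer X) (w : FreeGroup X) :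
    (sectionAt p w)⁻¹ = sectionAt p⁻¹ (p w) := by
  rw [inv_eq_iff_mul_eq_one]
  ext u
  simp only [mul_apply, sectionAt_apply, inv_apply_self, mul_inv_cancel_left]
  simp

/-! ### The action on letters and on words. -/

theorem exists_letter (p : baseStabilizer X) (x : X × Bool) :
    ∃ y, letterElt y = p (letterElt x) := by
  have h : (cayleyTree X).Adj 1 (letterElt x) := by simpa using cayleyTree_adj_mul 1 x
  have h' := p.1.map_rel_iff.2 h
  obtain ⟨y, hy⟩ := cayleyTree_adj.1 h'
  have e : p.1 1 = 1 := apply_one p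
  exact ⟨y, by rw [hy, e, one_mul]⟩

/-- The letter to which a letter is sent. -/
noncomputable def letter (p : baseStabilizer X) (x : X × Bool) : X × Bool :=
  (exists_letter p x).choose

@[simp]
theorem letterElt_letter (p : baseStabilizer X) (x : X × Bool) :
    letterElt (letter p x) = p (letterElt x) :=
  (exists_letter p x).choose_spec

theorem letter_eq_iff {p : baseStabilizer X} {x y : X × Bool} :
    letter p x = y ↔ p (letterElt x) = letterElt y := by
  rw [← letterElt_injective.eq_iff, letterElt_letter]

variable (X) in
/-- The automaton whose states are all the automorphisms fixing the base vertex. -/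
noncomputable def universalAutomaton : Automaton (X × Bool) (baseStabilizer X) where
  next x p := sectionAt p (letterElt x)
  out x p := letter p x

/-- Iterate `p (x * u) = p x * p_x u`, where `p_x` is the section at `x`. This is the equivariance
required of the final isomorphism. -/
theorem mk_transform (p : baseStabilizer X) (w : List (X × Bool)) :
    FreeGroup.mk ((universalAutomaton X).transform p w) = p (FreeGroup.mk w) := by
  induction w generalizing p with
  | nil => exact (apply_one p).symm
  | cons x w ih =>
    rw [Automaton.transform, mk_cons, mk_cons, ih]
    simp [universalAutomaton]

theorem transform_injective : Function.Injective (universalAutomaton X).transform := by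
  intro p q h
  ext v
  induction v using Quot.inductionOn with | _ w
  exact (mk_transform p w).symm.trans ((congrArg FreeGroup.mk (congrFun h w)).trans
    (mk_transform q w))

theorem transform_one (w : List (X × Bool)) : (universalAutomaton X).transform 1 w = w := by
  induction w with
  | nil => rfl
  | cons x w ih =>
    have h1 : letter 1 x = x := letter_eq_iff.2 rfl
    have h2 : sectionAt 1 (letterElt x) = 1 := by
      ext u
      change (letterElt x)⁻¹ * (letterElt x * u) = u
      simp
    simp only [Automaton.transform, universalAutomaton, h1, h2] at ih ⊢
    rw [ih]

theorem transform_mul (p q : baseStabilizer X) (w : List (X × Bool)) :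
    (universalAutomaton X).transform (p * q) w =
      (universalAutomaton X).transform p ((universalAutomaton X).transform q w) := by
  induction w generalizing p q with
  | nil => rfl
  | cons x w ih =>
    have h1 : letter (p * q) x = letter p (letter q x) := letter_eq_iff.2 (by simp)
    simp only [Automaton.transform, universalAutomaton, h1, mul_sectionAt, letterElt_letter] at ih ⊢
    rw [ih]

variable (X) in
/-- The action of the automorphisms fixing the base vertex on words. -/
noncomputable def wordAction : baseStabilizer X →* Equiv.Perm (List (X × Bool)) where
  toFun p :=
    { toFun := (universalAutomaton X).transform p
      invFun := (universalAutomaton X).transform p⁻¹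
      left_inv w := by rw [← transform_mul, inv_mul_cancel, transform_one]
      right_inv w := by rw [← transform_mul, mul_inv_cancel, transform_one] }
  map_one' := Equiv.ext transform_one
  map_mul' p q := Equiv.ext (transform_mul p q)

theorem wordAction_injective : Function.Injective (wordAction X) := fun _ _ h =>
  transform_injective (congrArg DFunLike.coe h)

/-! ### The commensurator -/

/-- With equal sections, the factorizations `p L_w = L_{p w} p_w` and `p L_v = L_{p v} p_v` give `p
L_w L_v⁻¹ p⁻¹ = L_{p w} L_{p v}⁻¹`. -/
theorem leftMul_conj_mem (p : baseStabilizer X) (w v : FreeGroup X)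
    (h : sectionAt p w = sectionAt p v) :
    p.1 * leftMulHom X (w * v⁻¹) * (p.1)⁻¹ ∈ freeLattice X := by
  refine ⟨p w * (p v)⁻¹, ?_⟩
  have h' := congrArg Subtype.val h
  simp only [sectionAt] at h'
  rw [map_mul, map_mul, map_inv, map_inv]
  have : p.1 * leftMulHom X w = leftMulHom X (p w) * (leftMulHom X (p v))⁻¹ *
      p.1 * leftMulHom X v := by
    rw [mul_assoc, inv_mul_eq_iff_eq_mul] at h'
    rw [h']
    group
  rw [← mul_assoc, this]
  group

/-- If the conjugate is left multiplication by `k`, then `p (w * u) = k * p (v * u)` for all `u`,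
and `k` cancels in the sections. -/
theorem sectionAt_eq_of_conj_mem (p : baseStabilizer X) (w v : FreeGroup X)
    (h : p.1 * leftMulHom X (w * v⁻¹) * (p.1)⁻¹ ∈ freeLattice X) :
    sectionAt p w = sectionAt p v := by
  obtain ⟨k, hk⟩ := h
  have key (u : FreeGroup X) : p (w * u) = k * p (v * u) := by
    have := congrArg (fun g : GraphAut (cayleyTree X) => g (p (v * u))) hk
    have h2 : (p.1 * leftMulHom X (w * v⁻¹) * (p.1)⁻¹) (p (v * u)) = p (w * u) := by
      change p (leftMulHom X (w * v⁻¹) (p⁻¹ (p (v * u)))) = _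
      rw [inv_apply_self, leftMulHom_apply]
      congr 1
      group
    exact h2.symm.trans this.symm
  ext u
  have h1 := key 1
  rw [mul_one, mul_one] at h1
  simp [key, h1, mul_assoc]

-- The index counts the cosets of the subgroup `K` of those `w` which `p` conjugates into the
-- lattice, and these cosets correspond bijectively to sections.
open scoped Pointwise in
theorem relIndex_conj_ne_zero_iff (p : baseStabilizer X) :
    (ConjAct.toConjAct (p.1)⁻¹ • freeLattice X).relIndex (freeLattice X) ≠ 0 ↔
      (Set.range (sectionAt p)).Finite := by
  let K := (ConjAct.toConjAct (p.1)⁻¹ • freeLattice X).comap (leftMulHom X)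
  have hK (w : FreeGroup X) : w ∈ K ↔ p.1 * leftMulHom X w * (p.1)⁻¹ ∈ freeLattice X := by
    rw [Subgroup.mem_comap, ConjAct.toConjAct_inv, Subgroup.mem_inv_pointwise_smul_iff,
      ConjAct.toConjAct_smul]
  -- Left cosets are governed by `w⁻¹ * v`, whereas sections compare through `w * v⁻¹`; hence the
  -- inverses.
  have hs (w v : FreeGroup X) : QuotientGroup.leftRel K w v ↔
      sectionAt p w⁻¹ = sectionAt p v⁻¹ := by
    rw [QuotientGroup.leftRel_apply, hK]
    constructor
    · intro h
      exact sectionAt_eq_of_conj_mem p _ _ (by rwa [inv_inv])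
    · intro h
      simpa using leftMul_conj_mem p _ _ h
  let F : FreeGroup X ⧸ K → Set.range (sectionAt p) :=
    Quotient.lift (fun w => ⟨sectionAt p w⁻¹, _, rfl⟩) fun w v h => Subtype.ext ((hs w v).1 h)
  have hF : Function.Bijective F := by
    constructor
    · intro a b h
      induction a using Quotient.inductionOn with | _ a
      induction b using Quotient.inductionOn with | _ b
      exact Quotient.sound ((hs a b).2 (congrArg Subtype.val h))
    · rintro ⟨_, w, rfl⟩
      exact ⟨QuotientGroup.mk w⁻¹, Subtype.ext (by change sectionAt p w⁻¹⁻¹ = _; rw [inv_inv])⟩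
  rw [freeLattice, ← Subgroup.index_comap, ← Subgroup.finiteIndex_iff,
    Subgroup.finiteIndex_iff_finite_quotient]
  exact (Equiv.ofBijective F hF).finite_iff

theorem finite_range_sectionAt_inv {p : baseStabilizer X} (h : (Set.range (sectionAt p)).Finite) :
    (Set.range (sectionAt p⁻¹)).Finite := by
  refine (h.image (·⁻¹)).subset ?_
  rintro _ ⟨w, rfl⟩
  refine ⟨_, ⟨p⁻¹ w, rfl⟩, ?_⟩
  simp only [inv_sectionAt, apply_inv_self]

-- The two indices in the definition of commensurability count the sections of `p⁻¹` and of `p`;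
-- each is finite iff the other is.
open scoped Pointwise in
theorem mem_commensurator_iff (p : baseStabilizer X) :
    p.1 ∈ Subgroup.Commensurable.commensurator (freeLattice X) ↔
      (Set.range (sectionAt p)).Finite := by
  have hinv : (ConjAct.toConjAct p.1 • freeLattice X).relIndex (freeLattice X) ≠ 0 ↔
      (Set.range (sectionAt p⁻¹)).Finite := by
    rw [← relIndex_conj_ne_zero_iff]
    simp
  constructor
  · intro h
    have h' := (hinv.1 h.1)
    simpa using finite_range_sectionAt_inv h'
  · intro h
    refine ⟨hinv.2 (finite_range_sectionAt_inv h), ?_⟩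
    -- Conjugation by `p` turns the index of `F ∩ p⁻¹Fp` in `F` into that of `pFp⁻¹ ∩ F` in `pFp⁻¹`.
    have := (relIndex_conj_ne_zero_iff p).2 h
    rwa [← Subgroup.relIndex_pointwise_smul (ConjAct.toConjAct p.1), ConjAct.toConjAct_inv,
      smul_inv_smul] at this

end baseStabilizer

end Sections

/-! ### Reversible automata -/

section Reversible

variable {X : Type u} {Q : Type v}

namespace Automaton

/-- The automaton has the symmetries of the automaton of a square complex with one vertex: the
square with sides `x`, `q` and opposite sides `x'`, `q'` may be read from its other corners. -/
structure IsReversible (A : Automaton (X × Bool) Q) (inv : Q → Q) : Prop where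
  next_next : ∀ x q, A.next (letterInv x) (A.next x q) = q
  out_next : ∀ x q, A.out (letterInv x) (A.next x q) = letterInv (A.out x q)
  next_out : ∀ x q, A.next (A.out x q) (inv q) = inv (A.next x q)
  out_out : ∀ x q, A.out (A.out x q) (inv q) = x

namespace IsReversible

variable {A : Automaton (X × Bool) Q} {inv : Q → Q}

theorem transform_transform (h : A.IsReversible inv) (q : Q) (w : List (X × Bool)) :
    A.transform (inv q) (A.transform q w) = w := by
  induction w generalizing q with
  | nil => rfl
  | cons x w ih => simp only [transform, h.next_out, h.out_out, ih]

/-- Reading a letter and then its inverse outputs a cancelling pair and returns to the same state,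
by `next_next` and `out_next`. -/
theorem mk_transform_step (h : A.IsReversible inv) (q : Q) {v w : List (X × Bool)}
    (hs : FreeGroup.Red.Step v w) :
    FreeGroup.mk (A.transform q v) = FreeGroup.mk (A.transform q w) := by
  obtain @⟨l₁, l₂, x, b⟩ := hs
  induction l₁ generalizing q with
  | nil =>
    change FreeGroup.mk (A.transform q ((x, b) :: letterInv (x, b) :: l₂)) = _
    simp [transform, h.next_next, h.out_next, mk_cons]
  | cons y l ih =>
    simp only [List.cons_append, transform, mk_cons]
    rw [ih]

/-- The transformation of the free group induced by a state. -/
def treeMap (h : A.IsReversible inv) (q : Q) : FreeGroup X → FreeGroup X :=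
  Quot.lift (fun w => FreeGroup.mk (A.transform q w)) fun _ _ hs => h.mk_transform_step q hs

theorem treeMap_mk (h : A.IsReversible inv) (q : Q) (w : List (X × Bool)) :
    h.treeMap q (FreeGroup.mk w) = FreeGroup.mk (A.transform q w) := rfl

theorem treeMap_one (h : A.IsReversible inv) (q : Q) : h.treeMap q 1 = 1 := rfl

theorem treeMap_letterElt_mul (h : A.IsReversible inv) (q : Q) (x : X × Bool) (v : FreeGroup X) :
    h.treeMap q (letterElt x * v) = letterElt (A.out x q) * h.treeMap (A.next x q) v := by
  induction v using Quot.inductionOn with | _ w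
  change h.treeMap q (letterElt x * FreeGroup.mk w) =
    letterElt (A.out x q) * h.treeMap (A.next x q) (FreeGroup.mk w)
  rw [← mk_cons, treeMap_mk, treeMap_mk, transform, mk_cons]

theorem treeMap_letterElt (h : A.IsReversible inv) (q : Q) (x : X × Bool) :
    h.treeMap q (letterElt x) = letterElt (A.out x q) := rfl

/-- Take for `r` the state reached after reading a word for `u`. Consequently adjacency is
preserved, and every section is the map of some state. -/
theorem exists_treeMap_mul (h : A.IsReversible inv) (q : Q) (u : FreeGroup X) :
    ∃ r, ∀ v, h.treeMap q (u * v) = h.treeMap q u * h.treeMap r v := by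
  induction u using Quot.inductionOn with | _ w
  change ∃ r, ∀ v, h.treeMap q (FreeGroup.mk w * v) = h.treeMap q (FreeGroup.mk w) * h.treeMap r v
  induction w generalizing q with
  | nil => exact ⟨q, fun v => by rw [← FreeGroup.one_eq_mk, one_mul, treeMap_one, one_mul]⟩
  | cons x w ih =>
    obtain ⟨r, hr⟩ := ih (A.next x q)
    exact ⟨r, fun v => by
      rw [mk_cons, mul_assoc, treeMap_letterElt_mul, treeMap_letterElt_mul, hr, mul_assoc]⟩

theorem treeMap_treeMap (h : A.IsReversible inv) (q : Q) (v : FreeGroup X) :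
    h.treeMap (inv q) (h.treeMap q v) = v := by
  induction v using Quot.inductionOn with | _ w
  exact congrArg FreeGroup.mk (h.transform_transform q w)

theorem treeMap_adj (h : A.IsReversible inv) (q : Q) {a b : FreeGroup X}
    (hab : (cayleyTree X).Adj a b) : (cayleyTree X).Adj (h.treeMap q a) (h.treeMap q b) := by
  obtain ⟨x, rfl⟩ := cayleyTree_adj.1 hab
  obtain ⟨r, hr⟩ := h.exists_treeMap_mul q a
  rw [hr, treeMap_letterElt]
  exact cayleyTree_adj_mul _ _

/-- The automorphism of the tree induced by a state. -/
def treeAut (h : A.IsReversible inv) (hi : Function.Involutive inv) (q : Q) : baseStabilizer X :=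
  ⟨{ toFun := h.treeMap q
     invFun := h.treeMap (inv q)
     left_inv := h.treeMap_treeMap q
     right_inv v := by simpa only [hi q] using h.treeMap_treeMap (inv q) v
     map_rel_iff' := ⟨fun hab => by
        simpa only [Equiv.coe_fn_mk, treeMap_treeMap] using h.treeMap_adj (inv q) hab,
        h.treeMap_adj q⟩ }, h.treeMap_one q⟩

theorem treeAut_apply (h : A.IsReversible inv) (hi : Function.Involutive inv) (q : Q)
    (v : FreeGroup X) : h.treeAut hi q v = h.treeMap q v := rfl

-- Sending a state to its tree automorphism is a morphism to the universal automaton.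
open baseStabilizer in
theorem transform_treeAut (h : A.IsReversible inv) (hi : Function.Involutive inv) (q : Q)
    (w : List (X × Bool)) :
    (universalAutomaton X).transform (h.treeAut hi q) w = A.transform q w := by
  refine transform_eq_of_semiconj (fun x r => ?_) (fun x r => ?_) q w
  · exact letter_eq_iff.2 rfl
  · refine baseStabilizer.ext fun v => ?_
    change sectionAt (h.treeAut hi r) (letterElt x) v = _
    rw [sectionAt_apply, treeAut_apply, treeAut_apply, treeAut_apply, treeMap_letterElt_mul,
      treeMap_letterElt, inv_mul_cancel_left]

open baseStabilizer in
theorem finite_range_sectionAt [Finite Q] (h : A.IsReversible inv)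
    (hi : Function.Involutive inv) (q : Q) : (Set.range (sectionAt (h.treeAut hi q))).Finite := by
  refine (Set.finite_range (h.treeAut hi)).subset ?_
  rintro _ ⟨u, rfl⟩
  obtain ⟨r, hr⟩ := h.exists_treeMap_mul q u
  refine ⟨r, baseStabilizer.ext fun v => ?_⟩
  rw [sectionAt_apply, treeAut_apply, treeAut_apply, treeAut_apply, hr, inv_mul_cancel_left]

end IsReversible

end Automaton

end Reversible

/-! ### The automaton of a complex is reversible -/

namespace VHComplex

variable {Y : VHComplex.{u}}

/-- The inversion of directed vertical edges. -/
def vinv (q : Y.VEdge) : Y.VEdge := ⟨Y.graph.inv q.1, fun h => q.2 ((Y.inv_mem _).1 h)⟩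

theorem vinv_involutive : Function.Involutive (vinv (Y := Y)) := fun _ =>
  Subtype.ext (Y.graph.inv_inv _)

section

variable (h1 : Y.HasOneVertex) (hT : Y.IsVHT)

/-- By uniqueness of the square at a corner, any directed square with the right two sides computes
the automaton. -/
theorem out_eq_of_square {x : Y.HEdge} {q : Y.VEdge} (s : Y.S) (hx : Y.side s 0 1 = x.1)
    (hq : Y.side s 0 3 = q.1) {x' : Y.HEdge} (hx' : Y.side s 3 2 = x'.1) :
    (automatonT h1 hT).out x q = x' := by
  refine Subtype.ext ?_
  rw [← hx', ← (existsUnique_square h1 hT x q).unique (square_spec h1 hT x q) ⟨hx, hq⟩]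
  rfl

theorem next_eq_of_square {x : Y.HEdge} {q : Y.VEdge} (s : Y.S) (hx : Y.side s 0 1 = x.1)
    (hq : Y.side s 0 3 = q.1) {q' : Y.VEdge} (hq' : Y.side s 1 2 = q'.1) :
    (automatonT h1 hT).next x q = q' := by
  refine Subtype.ext ?_
  rw [← hq', ← (existsUnique_square h1 hT x q).unique (square_spec h1 hT x q) ⟨hx, hq⟩]
  rfl

theorem isReversible_automatonT {X : Type w} (l : Y.HEdge ≃ X × Bool)
    (hl : ∀ x, l (Y.hinv x) = ((l x).1, !(l x).2)) :
    ((automatonT h1 hT).relabel l).IsReversible vinv := by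
  have hl' (x : X × Bool) : l.symm (letterInv x) = Y.hinv (l.symm x) := by
    rw [Equiv.symm_apply_eq, hl, Equiv.apply_symm_apply]; rfl
  have hl'' (x : Y.HEdge) : letterInv (l x) = l (Y.hinv x) := (hl x).symm
  have key (x : Y.HEdge) (q : Y.VEdge) : ∃ s : Y.S, Y.side s 0 1 = x.1 ∧ Y.side s 0 3 = q.1 ∧
      Y.side s 3 2 = ((automatonT h1 hT).out x q).1 ∧
      Y.side s 1 2 = ((automatonT h1 hT).next x q).1 :=
    ⟨square h1 hT x q, (square_spec h1 hT x q).1, (square_spec h1 hT x q).2, rfl, rfl⟩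
  -- The reflection `sr 3` exchanges corners `0, 1` and corners `2, 3`, hence the left and right
  -- sides; it yields `next_next` and `out_next`.
  have flip (x : Y.HEdge) (q : Y.VEdge) : ∃ s : Y.S, Y.side s 0 1 = (Y.hinv x).1 ∧
      Y.side s 0 3 = ((automatonT h1 hT).next x q).1 ∧
      Y.side s 3 2 = (Y.hinv ((automatonT h1 hT).out x q)).1 ∧ Y.side s 1 2 = q.1 := by
    obtain ⟨s, hx, hq, hx', hq'⟩ := key x q
    refine ⟨DihedralGroup.sr (3 : ZMod 4) • s, ?_, ?_, ?_, ?_⟩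
    · exact (Y.bdry_smul (.sr 3) s (circ4Edge 1 0)).trans
        ((Y.inv_side s 0 1 (by decide) (by decide)).symm.trans (congrArg Y.graph.inv hx))
    · exact (Y.bdry_smul (.sr 3) s (circ4Edge 1 2)).trans hq'
    · exact (Y.bdry_smul (.sr 3) s (circ4Edge 2 3)).trans
        ((Y.inv_side s 3 2 (by decide) (by decide)).symm.trans (congrArg Y.graph.inv hx'))
    · exact (Y.bdry_smul (.sr 3) s (circ4Edge 0 3)).trans hq
  -- The reflection `sr 1` exchanges corners `0, 3` and corners `1, 2`, hence the bottom and top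
  -- sides; it yields `next_out` and `out_out`.
  have flop (x : Y.HEdge) (q : Y.VEdge) : ∃ s : Y.S,
      Y.side s 0 1 = ((automatonT h1 hT).out x q).1 ∧ Y.side s 0 3 = (vinv q).1 ∧
      Y.side s 3 2 = x.1 ∧ Y.side s 1 2 = (vinv ((automatonT h1 hT).next x q)).1 := by
    obtain ⟨s, hx, hq, hx', hq'⟩ := key x q
    refine ⟨DihedralGroup.sr (1 : ZMod 4) • s, ?_, ?_, ?_, ?_⟩
    · exact (Y.bdry_smul (.sr 1) s (circ4Edge 3 2)).trans hx'
    · exact (Y.bdry_smul (.sr 1) s (circ4Edge 3 0)).trans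
        ((Y.inv_side s 0 3 (by decide) (by decide)).symm.trans (congrArg Y.graph.inv hq))
    · exact (Y.bdry_smul (.sr 1) s (circ4Edge 0 1)).trans hx
    · exact (Y.bdry_smul (.sr 1) s (circ4Edge 2 1)).trans
        ((Y.inv_side s 1 2 (by decide) (by decide)).symm.trans (congrArg Y.graph.inv hq'))
  constructor <;> intro x q
  · obtain ⟨s, hx, hq, hx', hq'⟩ := flip (l.symm x) q
    simp only [Automaton.relabel, hl']
    exact next_eq_of_square h1 hT s hx hq hq'
  · obtain ⟨s, hx, hq, hx', hq'⟩ := flip (l.symm x) q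
    simp only [Automaton.relabel, hl', hl'']
    exact congrArg l (out_eq_of_square h1 hT s hx hq hx')
  · obtain ⟨s, hx, hq, hx', hq'⟩ := flop (l.symm x) q
    simp only [Automaton.relabel, Equiv.symm_apply_apply]
    exact next_eq_of_square h1 hT s hx hq hq'
  · obtain ⟨s, hx, hq, hx', hq'⟩ := flop (l.symm x) q
    simp only [Automaton.relabel, Equiv.symm_apply_apply]
    rw [out_eq_of_square h1 hT s hx hq hx', Equiv.apply_symm_apply]

end

end VHComplex

/-! ### The complex of a reversible automaton -/

theorem circ4Edge_induction {p : Circ4Edge → Prop} (h01 : p (circ4Edge 0 1))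
    (h10 : p (circ4Edge 1 0)) (h03 : p (circ4Edge 0 3)) (h30 : p (circ4Edge 3 0))
    (h12 : p (circ4Edge 1 2)) (h21 : p (circ4Edge 2 1)) (h32 : p (circ4Edge 3 2))
    (h23 : p (circ4Edge 2 3)) (e : Circ4Edge) : p e := by
  have h : e = circ4Edge 0 1 ∨ e = circ4Edge 1 0 ∨ e = circ4Edge 0 3 ∨ e = circ4Edge 3 0 ∨
      e = circ4Edge 1 2 ∨ e = circ4Edge 2 1 ∨ e = circ4Edge 3 2 ∨ e = circ4Edge 2 3 := by
    revert e
    decide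
  rcases h with rfl | rfl | rfl | rfl | rfl | rfl | rfl | rfl <;> assumption

theorem circ4ActEdge_one (e : Circ4Edge) : circ4ActEdge 1 e = e :=
  Subtype.ext (Prod.ext (circ4Act_one _) (circ4Act_one _))

theorem circ4ActEdge_mul (g h : DihedralGroup 4) (e : Circ4Edge) :
    circ4ActEdge (g * h) e = circ4ActEdge g (circ4ActEdge h e) :=
  Subtype.ext (Prod.ext (circ4Act_mul _ _ _) (circ4Act_mul _ _ _))

namespace Automaton

variable {X : Type u} {Q : Type u}

/-- The boundary of the square of an automaton with lower side `x` and left side `q`. -/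
def boundary (A : Automaton (X × Bool) Q) (inv : Q → Q) (x : X × Bool) (q : Q) (e : Circ4Edge) :
    (X × Bool) ⊕ Q :=
  if e = circ4Edge 0 1 then .inl x
  else if e = circ4Edge 1 0 then .inl (letterInv x)
  else if e = circ4Edge 0 3 then .inr q
  else if e = circ4Edge 3 0 then .inr (inv q)
  else if e = circ4Edge 1 2 then .inr (A.next x q)
  else if e = circ4Edge 2 1 then .inr (inv (A.next x q))
  else if e = circ4Edge 3 2 then .inl (A.out x q)
  else .inl (letterInv (A.out x q))

/-- The boundaries of the directed squares. -/
def IsBoundary (A : Automaton (X × Bool) Q) (inv : Q → Q) (b : Circ4Edge → (X × Bool) ⊕ Q) : Prop :=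
  ∃ x q, b = A.boundary inv x q ∨ b = A.boundary inv x q ∘ circ4ActEdge (.sr 0)

namespace IsReversible

variable {A : Automaton (X × Bool) Q} {inv : Q → Q}

theorem boundary_comp_sr_three (h : A.IsReversible inv) (x : X × Bool) (q : Q) :
    A.boundary inv x q ∘ circ4ActEdge (.sr 3) = A.boundary inv (letterInv x) (A.next x q) := by
  funext e
  induction e using circ4Edge_induction
  · rfl
  · exact congrArg Sum.inl (letterInv_letterInv x).symm
  · rfl
  · rfl
  · exact congrArg Sum.inr (h.next_next x q).symm
  · exact congrArg (Sum.inr ∘ inv) (h.next_next x q).symm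
  · exact congrArg Sum.inl (h.out_next x q).symm
  · exact congrArg Sum.inl ((letterInv_letterInv _).symm.trans
      (congrArg letterInv (h.out_next x q).symm))

theorem boundary_comp_sr_one (h : A.IsReversible inv) (hi : Function.Involutive inv)
    (x : X × Bool) (q : Q) :
    A.boundary inv x q ∘ circ4ActEdge (.sr 1) = A.boundary inv (A.out x q) (inv q) := by
  funext e
  induction e using circ4Edge_induction
  · rfl
  · rfl
  · rfl
  · exact congrArg Sum.inr (hi q).symm
  · exact congrArg Sum.inr (h.next_out x q).symm
  · exact congrArg Sum.inr ((hi _).symm.trans (congrArg inv (h.next_out x q).symm))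
  · exact congrArg Sum.inl (h.out_out x q).symm
  · exact congrArg (Sum.inl ∘ letterInv) (h.out_out x q).symm

/-- The dihedral group is generated by `sr 0` and `sr 1`. The first exchanges the two kinds of
boundary; the second preserves each kind, by reversibility. -/
theorem isBoundary_comp (h : A.IsReversible inv) (hi : Function.Involutive inv)
    (g : DihedralGroup 4) {b : Circ4Edge → (X × Bool) ⊕ Q} (hb : A.IsBoundary inv b) :
    A.IsBoundary inv (b ∘ circ4ActEdge g) := by
  have comp (g k : DihedralGroup 4) (b : Circ4Edge → (X × Bool) ⊕ Q) :
      b ∘ circ4ActEdge (g * k) = (b ∘ circ4ActEdge g) ∘ circ4ActEdge k := by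
    funext e
    simp only [Function.comp, circ4ActEdge_mul]
  have comp_one (b : Circ4Edge → (X × Bool) ⊕ Q) : b ∘ circ4ActEdge 1 = b := by
    funext e
    simp only [Function.comp, circ4ActEdge_one]
  have h0 {b} (hb : A.IsBoundary inv b) : A.IsBoundary inv (b ∘ circ4ActEdge (.sr 0)) := by
    obtain ⟨x, q, rfl | rfl⟩ := hb
    · exact ⟨x, q, Or.inr rfl⟩
    · refine ⟨x, q, Or.inl ?_⟩
      rw [← comp, DihedralGroup.sr_mul_sr, sub_self, ← DihedralGroup.one_def, comp_one]
  have h1 {b} (hb : A.IsBoundary inv b) : A.IsBoundary inv (b ∘ circ4ActEdge (.sr 1)) := by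
    obtain ⟨x, q, rfl | rfl⟩ := hb
    · exact ⟨_, _, Or.inl (h.boundary_comp_sr_one hi x q)⟩
    -- Both `sr 0 * sr 1` and `sr 3 * sr 0` equal `r 1`, so the known effect of `sr 3` applies.
    · refine ⟨letterInv x, A.next x q, Or.inr ?_⟩
      rw [← h.boundary_comp_sr_three, ← comp, ← comp]
      rfl
  have hr {b} (hb : A.IsBoundary inv b) (n : ℕ) :
      A.IsBoundary inv (b ∘ circ4ActEdge (.r 1 ^ n)) := by
    induction n with
    | zero => rwa [pow_zero, comp_one]
    | succ n ih =>
      have e : (.r 1 : DihedralGroup 4) = .sr 0 * .sr 1 := rfl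
      rw [pow_succ, comp, e, comp]
      exact h1 (h0 ih)
  rcases g with i | i
  · have := hr hb i.val
    rwa [DihedralGroup.r_one_pow, ZMod.natCast_zmod_val] at this
  · have := hr (h0 hb) i.val
    rwa [DihedralGroup.r_one_pow, ZMod.natCast_zmod_val, ← comp, DihedralGroup.sr_mul_r,
      zero_add] at this

/-- Half of the symmetries exchange letters and states. Of the others, `sr 1` and `sr 3` would
invert an edge onto itself, and the half turn `r 2` is excluded by `hfree`. -/
theorem eq_one_of_boundary_comp (hne : ∀ q, inv q ≠ q) (hi : Function.Involutive inv)
    (hfree : ∀ x q, ¬ (A.out x q = letterInv x ∧ A.next x q = inv q)) {x : X × Bool} {q : Q}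
    {g : DihedralGroup 4}
    (hg : ∀ e, A.boundary inv x q (circ4ActEdge g e) = A.boundary inv x q e) : g = 1 := by
  have h1 := hg (circ4Edge 0 1)
  have h3 := hg (circ4Edge 0 3)
  rcases g with i | i
  · have hi4 : i = 0 ∨ i = 1 ∨ i = 2 ∨ i = 3 := by clear hg h1 h3; revert i; decide
    rcases hi4 with rfl | rfl | rfl | rfl
    · rfl
    · exact absurd h1 Sum.inr_ne_inl
    · have h1' : letterInv (A.out x q) = x := Sum.inl_injective h1
      have h3' : inv (A.next x q) = q := Sum.inr_injective h3
      exact (hfree x q ⟨by rw [← h1', letterInv_letterInv, h1'], by rw [← hi (A.next x q), h3']⟩).elim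
    · exact absurd h1 Sum.inr_ne_inl
  · have hi4 : i = 0 ∨ i = 1 ∨ i = 2 ∨ i = 3 := by clear hg h1 h3; revert i; decide
    rcases hi4 with rfl | rfl | rfl | rfl
    · exact absurd h1 Sum.inr_ne_inl
    · exact absurd (Sum.inr_injective h3) (hne q)
    · exact absurd h1 Sum.inr_ne_inl
    · exact absurd (Sum.inl_injective h1) (letterInv_ne x)

/-- The graph with one vertex whose edges are the letters and the states. -/
def edgeGraph (X : Type u) (hi : Function.Involutive inv) (hne : ∀ q, inv q ≠ q) :
    SerreGraph PUnit.{u + 1} ((X × Bool) ⊕ Q) where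
  o _ := ⟨⟩
  t _ := ⟨⟩
  inv := Sum.map letterInv inv
  inv_inv e := by cases e <;> simp [hi _]
  inv_ne e := by cases e <;> simp [letterInv_ne, hne]
  o_inv _ := rfl

theorem inv_boundary (hi : Function.Involutive inv) (x : X × Bool) (q : Q) (e : Circ4Edge) :
    Sum.map letterInv inv (A.boundary inv x q e) = A.boundary inv x q (circ4.inv e) := by
  induction e using circ4Edge_induction
  · rfl
  · exact congrArg Sum.inl (letterInv_letterInv _)
  · rfl
  · exact congrArg Sum.inr (hi _)
  · rfl
  · exact congrArg Sum.inr (hi _)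
  · rfl
  · exact congrArg Sum.inl (letterInv_letterInv _)

variable (h : A.IsReversible inv) (hi : Function.Involutive inv) (hne : ∀ q, inv q ≠ q)
  (hfree : ∀ x q, ¬ (A.out x q = letterInv x ∧ A.next x q = inv q))

/-- The square complex of a reversible automaton. -/
def squareComplex : SquareComplex.{u} where
  V := PUnit
  E := (X × Bool) ⊕ Q
  -- A directed square is identified with its labelled boundary, so the action is free as soon as no
  -- labelling has a symmetry.
  S := {b // A.IsBoundary inv b}
  graph := edgeGraph X hi hne
  bdry s :=
    { onV := fun _ => ⟨⟩
      onE := s.1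
      o_onE := fun _ => rfl
      inv_onE := by
        obtain ⟨_, x, q, rfl | rfl⟩ := s
        · exact inv_boundary hi x q
        · exact fun e => inv_boundary hi x q _ }
  action :=
    { smul := fun g s => ⟨s.1 ∘ circ4ActEdge g⁻¹, h.isBoundary_comp hi _ s.2⟩
      one_smul := fun s => Subtype.ext <| funext fun e => congrArg s.1 <| by
        rw [inv_one, circ4ActEdge_one]
      mul_smul := fun g k s => Subtype.ext <| funext fun e => congrArg s.1 <| by
        rw [mul_inv_rev, circ4ActEdge_mul] }
  smul_free g s hs := by
    have hs' (e : Circ4Edge) : s.1 (circ4ActEdge g⁻¹ e) = s.1 e :=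
      congrFun (congrArg Subtype.val hs) e
    obtain ⟨_, x, q, rfl | rfl⟩ := s
    · exact inv_eq_one.1 (eq_one_of_boundary_comp hne hi hfree hs')
    -- A symmetry of a boundary twisted by `sr 0` is, after conjugation by `sr 0`, a symmetry of the
    -- untwisted one.
    · have key : (.sr 0 : DihedralGroup 4) * g⁻¹ * .sr 0 = 1 := by
        refine eq_one_of_boundary_comp (A := A) (x := x) (q := q) hne hi hfree fun e => ?_
        have := hs' (circ4ActEdge (.sr 0) e)
        simp only [Function.comp, ← circ4ActEdge_mul] at this
        rw [mul_assoc, this, DihedralGroup.sr_mul_sr, sub_self, ← DihedralGroup.one_def,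
          circ4ActEdge_one]
      have h0 : (.sr 0 : DihedralGroup 4)⁻¹ = .sr 0 := rfl
      rw [mul_assoc, ← eq_inv_mul_iff_mul_eq, mul_one, h0] at key
      simpa using key
  bdry_smul g s e := by
    change s.1 (circ4ActEdge g⁻¹ (circ4ActEdge g e)) = s.1 e
    rw [← circ4ActEdge_mul, inv_mul_cancel, circ4ActEdge_one]

/-- The complex of a reversible automaton. -/
def complex : VHComplex.{u} where
  toSquareComplex := h.squareComplex hi hne hfree
  horizontal := Set.range Sum.inl
  inv_mem e := by
    change Sum.map letterInv inv e ∈ _ ↔ _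
    rcases e with x | q
    · exact iff_of_true ⟨_, rfl⟩ ⟨_, rfl⟩
    · exact iff_of_false (fun ⟨_, h⟩ => Sum.inl_ne_inr h) (fun ⟨_, h⟩ => Sum.inl_ne_inr h)
  link_bipartite := by
    rintro v ⟨⟨_, x, q, rfl | rfl⟩, hs⟩
    · exact iff_of_true ⟨x, rfl⟩ fun ⟨y, hy⟩ => Sum.inl_ne_inr (hy : Sum.inl y = Sum.inr q)
    · exact iff_of_false (fun ⟨y, hy⟩ => Sum.inl_ne_inr (hy : Sum.inl y = Sum.inr q))
        (not_not_intro ⟨x, rfl⟩)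

theorem isFinite_complex [Finite X] [Finite Q] : (h.complex hi hne hfree).IsFinite :=
  ⟨inferInstanceAs (Finite PUnit), inferInstanceAs (Finite ((X × Bool) ⊕ Q)),
    inferInstanceAs (Finite {b // A.IsBoundary inv b})⟩

theorem hasOneVertex_complex : (h.complex hi hne hfree).HasOneVertex := ⟨⟨⟩, fun _ => rfl⟩

/-- A letter and a state determine one untwisted boundary; twisted ones have a state as first side
at corner `0`, so they give no second edge from the letter to the state. -/
theorem isVHT_complex : (h.complex hi hne hfree).IsVHT := by
  refine fun v => ⟨(h.complex hi hne hfree).link_bipartite v, ?_⟩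
  rintro ⟨_, ha⟩ ⟨x, rfl⟩ ⟨y | q, hb⟩ hy
  · exact absurd ⟨y, rfl⟩ hy
  refine ⟨⟨⟨A.boundary inv x q, x, q, Or.inl rfl⟩, rfl⟩, ⟨rfl, rfl⟩, ?_⟩
  rintro ⟨⟨_, y, r, rfl | rfl⟩, hs⟩ ⟨h1, h2⟩
  · have h1' : y = x := Sum.inl_injective (congrArg Subtype.val h1)
    have h2' : r = q := Sum.inr_injective (congrArg Subtype.val h2)
    subst h1' h2'
    rfl
  · have h1' : Sum.inr r = Sum.inl x := congrArg Subtype.val h1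
    exact absurd h1' Sum.inr_ne_inl

/-- The directed horizontal edges of the complex are the letters. -/
noncomputable def hEdgeEquiv : (h.complex hi hne hfree).HEdge ≃ X × Bool :=
  (Equiv.ofInjective (Sum.inl : X × Bool → (X × Bool) ⊕ Q) Sum.inl_injective).symm

theorem hEdgeEquiv_apply (x : X × Bool) :
    h.hEdgeEquiv hi hne hfree ⟨Sum.inl x, x, rfl⟩ = x :=
  Equiv.ofInjective_symm_apply Sum.inl_injective x

theorem transform_mem_vhtTransformations [Finite X] [Finite Q] (h : A.IsReversible inv)
    (hi : Function.Involutive inv) (hne : ∀ q, inv q ≠ q)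
    (hfree : ∀ x q, ¬ (A.out x q = letterInv x ∧ A.next x q = inv q)) (q : Q) :
    A.transform q ∈ vhtTransformations X := by
  let Y := h.complex hi hne hfree
  let f (q : Q) : Y.VEdge := ⟨Sum.inr q, fun ⟨y, hy⟩ => Sum.inl_ne_inr hy⟩
  have h1 := h.hasOneVertex_complex hi hne hfree
  have hT := h.isVHT_complex hi hne hfree
  refine ⟨Y, h.isFinite_complex hi hne hfree, h1, hT, h.hEdgeEquiv hi hne hfree, ?_, f q, ?_⟩
  · rintro ⟨_, x, rfl⟩
    exact (h.hEdgeEquiv_apply hi hne hfree (letterInv x)).trans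
      (congrArg letterInv (h.hEdgeEquiv_apply hi hne hfree x).symm)
  · funext w
    refine (transform_eq_of_semiconj (f := f) (fun x r => ?_) (fun x r => ?_) q w).symm
    · refine Eq.trans ?_ (h.hEdgeEquiv_apply hi hne hfree (A.out x r))
      refine congrArg (h.hEdgeEquiv hi hne hfree) ?_
      exact VHComplex.out_eq_of_square h1 hT
        (⟨A.boundary inv x r, x, r, Or.inl rfl⟩ : Y.S) rfl rfl rfl
    · exact VHComplex.next_eq_of_square h1 hT
        (⟨A.boundary inv x r, x, r, Or.inl rfl⟩ : Y.S) rfl rfl rfl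

end IsReversible

end Automaton

/-! ### Transformations and the commensurator -/

namespace baseStabilizer

variable {X : Type u}

theorem letter_sectionAt_letterInv (p : baseStabilizer X) (x : X × Bool) :
    letter (sectionAt p (letterElt x)) (letterInv x) = letterInv (letter p x) := by
  simp [letter_eq_iff]

theorem letter_inv_letter (p : baseStabilizer X) (x : X × Bool) :
    letter p⁻¹ (letter p x) = x := by
  simp only [letter_eq_iff, letterElt_letter, inv_apply_self]

/-- The sections of `p` and their inverses. -/
def sections (p : baseStabilizer X) : Set (baseStabilizer X) :=
  {r | r ∈ Set.range (sectionAt p) ∨ r⁻¹ ∈ Set.range (sectionAt p)}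

theorem inv_mem_sections {p r : baseStabilizer X} (h : r ∈ sections p) : r⁻¹ ∈ sections p := by
  rcases h with h | h
  · exact Or.inr (by rwa [inv_inv])
  · exact Or.inl h

theorem sectionAt_mem_sections {p r : baseStabilizer X} (h : r ∈ sections p) (w : FreeGroup X) :
    sectionAt r w ∈ sections p := by
  rcases h with ⟨v, rfl⟩ | ⟨v, h⟩
  · exact Or.inl ⟨v * w, (sectionAt_sectionAt p v w).symm⟩
  -- The inverse of the section of `r` at `w` is the section of `r⁻¹` at `r w`, and `r⁻¹` is the
  -- section of `p` at `v`.
  · exact Or.inr ⟨v * r w, by rw [inv_sectionAt, ← h, sectionAt_sectionAt]⟩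

theorem finite_sections {p : baseStabilizer X} (h : (Set.range (sectionAt p)).Finite) :
    (sections p).Finite :=
  h.union (Set.Finite.preimage (s := Set.range (sectionAt p)) inv_injective.injOn h)

/-- The automaton of the sections of `p` and their inverses. Each state is doubled, in order that
its inverse is a different state. -/
noncomputable def sectionAutomaton (p : baseStabilizer X) :
    Automaton (X × Bool) (sections p × Bool) where
  next x r := (⟨sectionAt r.1 (letterElt x), sectionAt_mem_sections r.1.2 _⟩, r.2)
  out x r := letter r.1 x

/-- The inversion of the states of the automaton of sections. -/
def sectionInv (p : baseStabilizer X) (r : sections p × Bool) : sections p × Bool :=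
  (⟨r.1.1⁻¹, inv_mem_sections r.1.2⟩, !r.2)

theorem sectionInv_involutive (p : baseStabilizer X) : Function.Involutive (sectionInv p) :=
  fun r => Prod.ext (Subtype.ext (inv_inv r.1.1)) (Bool.not_not r.2)

theorem isReversible_sectionAutomaton (p : baseStabilizer X) :
    (sectionAutomaton p).IsReversible (sectionInv p) where
  next_next x r := Prod.ext (Subtype.ext (by
    simp only [sectionAutomaton, sectionAt_sectionAt, letterElt_letterInv, mul_inv_cancel,
      sectionAt_one])) rfl
  out_next x r := letter_sectionAt_letterInv r.1.1 x
  next_out x r := Prod.ext (Subtype.ext (by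
    simp only [sectionAutomaton, sectionInv, letterElt_letter, inv_sectionAt])) rfl
  out_out x r := letter_inv_letter r.1.1 x

theorem transform_mem_vhtTransformations [Finite X] {p : baseStabilizer X}
    (h : (Set.range (sectionAt p)).Finite) :
    (universalAutomaton X).transform p ∈ vhtTransformations X := by
  have : Finite (sections p) := finite_sections h
  let q : sections p × Bool := (⟨p, Or.inl ⟨1, sectionAt_one p⟩⟩, true)
  have e : (universalAutomaton X).transform p = (sectionAutomaton p).transform q :=
    funext fun w => Automaton.transform_eq_of_semiconj (A := sectionAutomaton p)
      (f := fun r => r.1.1) (fun _ _ => rfl) (fun _ _ => rfl) q w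
  rw [e]
  refine (isReversible_sectionAutomaton p).transform_mem_vhtTransformations
    (sectionInv_involutive p) (fun r hr => ?_) (fun x r hr => ?_) q
  -- Inversion flips the flag while transitions keep it, which rules out both self-inverse states
  -- and half-turn symmetric squares.
  · exact Bool.not_ne_self r.2 (congrArg Prod.snd hr)
  · exact Bool.not_ne_self r.2 (congrArg Prod.snd hr.2).symm

theorem mem_vhtTransformations_iff [Finite X] {f : List (X × Bool) → List (X × Bool)} :
    f ∈ vhtTransformations X ↔
      ∃ p : baseStabilizer X, p.1 ∈ Subgroup.Commensurable.commensurator (freeLattice X) ∧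
        (universalAutomaton X).transform p = f := by
  constructor
  · rintro ⟨Y, hY, h1, hT, l, hl, q, rfl⟩
    have : Finite Y.E := hY.2.1
    have hr := VHComplex.isReversible_automatonT h1 hT l hl
    exact ⟨hr.treeAut VHComplex.vinv_involutive q,
      (mem_commensurator_iff _).2 (hr.finite_range_sectionAt _ q),
      funext (hr.transform_treeAut _ q)⟩
  · rintro ⟨p, hp, rfl⟩
    exact transform_mem_vhtTransformations ((mem_commensurator_iff p).1 hp)

end baseStabilizer

open baseStabilizer in
theorem mainTheorem5 (X : Type*) [Finite X] :
    -- the Cayley graph of the free group is the `2|X|`-regular tree, with the free group as a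
    -- uniform lattice in its automorphism group
    (cayleyTree X).IsTree ∧
    (∀ v, ((cayleyTree X).neighborSet v).encard = (2 * Nat.card X : ℕ)) ∧
    Function.Injective (leftMulHom X) ∧
    IsUniformLattice (freeLattice X) ∧
    -- the transformations form a group under composition
    ∃ G : Subgroup (Equiv.Perm (List (X × Bool))),
      (fun g : Equiv.Perm (List (X × Bool)) => (g : List (X × Bool) → List (X × Bool))) ''
        (G : Set (Equiv.Perm (List (X × Bool)))) = vhtTransformations X ∧
      -- it is naturally isomorphic to the vertex stabilizer of the commensurator: the isomorphism
      -- is equivariant for the map from words in `X^±` to the free group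
      ∃ Ψ : G ≃* commensuratorStabilizer X,
        ∀ (g : G) (w : List (X × Bool)),
          (Ψ g : GraphAut (cayleyTree X)) (FreeGroup.mk w) =
            FreeGroup.mk ((g : Equiv.Perm (List (X × Bool))) w) := by
  refine ⟨cayleyTree_isTree, encard_neighborSet_cayleyTree, leftMulHom_injective,
    isUniformLattice_freeLattice, ?_⟩
  -- Taking the group to be the range of this faithful action makes closure under composition
  -- automatic, and `Ψ` is the inverse of the action onto its range.
  let F : commensuratorStabilizer X →* Equiv.Perm (List (X × Bool)) :=
    (wordAction X).comp (Subgroup.inclusion inf_le_right)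
  have hF : Function.Injective F :=
    wordAction_injective.comp (Subgroup.inclusion_injective _)
  refine ⟨F.range, ?_, (MonoidHom.ofInjective hF).symm, fun g w => ?_⟩
  · ext f
    rw [mem_vhtTransformations_iff]
    constructor
    · rintro ⟨_, ⟨c, rfl⟩, rfl⟩
      exact ⟨⟨c.1, c.2.2⟩, c.2.1, rfl⟩
    · rintro ⟨p, hp, rfl⟩
      exact ⟨_, ⟨⟨p.1, hp, p.2⟩, rfl⟩, rfl⟩
  · obtain ⟨c, rfl⟩ := (MonoidHom.ofInjective hF).surjective g
    rw [MulEquiv.symm_apply_apply]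
    exact (mk_transform ⟨c.1, c.2.2⟩ w).symm
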